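/- Let $1\to A\xrightarrow{\alpha}B\xrightarrow{\beta}C\to 1$ be a central extension of Lie groups (an exact sequence of smooth homomorphisms with $\alpha(A)$ central in $B$ and $\beta$ a principal $A$-bundle), with induced maps $\alpha_*\colon\mathfrak a\to\mathfrak b$ and $\beta_*\colon\mathfrak b\to\mathfrak c$ of Lie algebras. Assume given an $\mathrm{Ad}|_B$-equivariant linear section $s\colon\mathfrak c\to\mathfrak b$ of $\beta_*$, that is, $\beta_*s=1$ and $s\circ\mathrm{Ad}_{\beta(b)}=\mathrm{Ad}_b\circ s$ for all $b\in B$, and let $t\colon\mathfrak b\to\mathfrak a$ be the linear map determined by $1=\alpha_*t+s\beta_*$. Let $G$ be a Lie group acting on a manifold $X$, and let $\rho\colon R\xrightarrow{\sigma}P\xrightarrow{\pi}X$ be a $G$-equivariant central extension: $\pi\colon P\to X$ is a $G$-equivariant principal $C$-bundle, $\rho=\pi\circ\sigma\colon R\to X$ is a $G$-equivariant principal $B$-bundle, and $\sigma$ is a smooth $G$-equivariant map with $\sigma(rb)=\sigma(r)\beta(b)$ for all $r\in R$, $b\in B$. Via $\alpha$, the group $A$ acts on $R$ and $\sigma$ is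 a principal $A$-bundle. Let $\psi\colon R\times_XR\to B$ be the difference map, $r_1\psi(r_1,r_2)=r_2$, and let $\theta_B$ be the left Maurer–Cartan form of $B$. Then the $G$-invariant connection $1$-forms $\omega^\rho\in\Omega^1(R;\mathfrak b)$ on $\rho$ are parametrized by the pairs $(\omega^\sigma,\omega^\pi)$ of $G$-invariant connection $1$-forms $\omega^\sigma\in\Omega^1(R;\mathfrak a)$ on $\sigma$ and $\omega^\pi\in\Omega^1(P;\mathfrak c)$ on $\pi$ that satisfy \[ \mathrm{pr}_2^*\omega^\sigma-\mathrm{pr}_1^*\omega^\sigma=\psi^*t(\theta_B)\in\Omega^1(R\times_XR;\mathfrak a). \] More precisely, $(\omega^\sigma,\omega^\pi)\mapsto\omega^\rho=\alpha_*\omega^\sigma+s(\sigma^*\omega^\pi)$ is a bijection from the set of these pairs onto the set of $G$-invariant connection $1$-forms on $\rho$, and for corresponding forms $\omega^\sigma=t(\omega^\rho)$ and $\sigma^*\omega^\pi=\beta_*(\omega^\rho)$. -/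

import Mathlib

open scoped Manifold ContDiff

noncomputable section

namespace CentralExt

/-! ### One-forms, Lie algebras, the adjoint action and the Maurer-Cartan form -/

section Forms

variable {E : Type*} [NormedAddCommGroup E] [NormedSpace ℝ E] {H : Type*} [TopologicalSpace H]
  (I : ModelWithCorners ℝ E H)
  {E' : Type*} [NormedAddCommGroup E'] [NormedSpace ℝ E'] {H' : Type*} [TopologicalSpace H']
  (I' : ModelWithCorners ℝ E' H')

/-- A (not necessarily smooth) `1`-form on `M` with values in a topological vector space `V`. -/
abbrev OneForm (M : Type*) [TopologicalSpace M] [ChartedSpace H M]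
    (V : Type*) [TopologicalSpace V] [AddCommGroup V] [Module ℝ V] : Type _ :=
  ∀ x : M, TangentSpace I x →L[ℝ] V

variable {I} in
/-- The pullback `f^* η` of a `1`-form. -/
def OneForm.pullback {I' : ModelWithCorners ℝ E' H'}
    {M : Type*} [TopologicalSpace M] [ChartedSpace H M]
    {N : Type*} [TopologicalSpace N] [ChartedSpace H' N]
    {V : Type*} [TopologicalSpace V] [AddCommGroup V] [Module ℝ V]
    (f : N → M) (η : OneForm I M V) : OneForm I' N V :=
  fun x => (η (f x)).comp (mfderiv I' I f x)

variable {I} in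
/-- Composition `L ∘ η` of a `1`-form with a linear map of the coefficients. -/
def OneForm.map {M : Type*} [TopologicalSpace M] [ChartedSpace H M]
    {V W : Type*} [TopologicalSpace V] [AddCommGroup V] [Module ℝ V]
    [TopologicalSpace W] [AddCommGroup W] [Module ℝ W]
    (L : V →L[ℝ] W) (η : OneForm I M V) : OneForm I M W :=
  fun x => L.comp (η x)

variable {I I'} in
/-- A `1`-form with values in the Lie algebra of `K` is smooth if it is smooth as a map from the
tangent bundle to the (normed) vector space underlying the Lie algebra. -/
def OneForm.IsSmooth {M : Type*} [TopologicalSpace M] [ChartedSpace H M] [IsManifold I ∞ M]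
    {K : Type*} [TopologicalSpace K] [ChartedSpace H' K] [Group K]
    (η : OneForm I M (GroupLieAlgebra I' K)) : Prop :=
  ContMDiff I.tangent 𝓘(ℝ, E') ∞
    (fun v : TangentBundle I M => (show E' from η v.proj v.snd))

/-- The map `f_*` of Lie algebras induced by a homomorphism of Lie groups. Its values lie in the
tangent space at `f 1 = 1`. -/
def lieMap {K : Type*} [TopologicalSpace K] [ChartedSpace H K] [Group K]
    {L : Type*} [TopologicalSpace L] [ChartedSpace H' L] [Group L] (f : K →* L) :
    GroupLieAlgebra I K →L[ℝ] GroupLieAlgebra I' L :=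
  mfderiv I I' f 1

variable {K : Type*} [TopologicalSpace K] [ChartedSpace H K] [Group K]

/-- The adjoint action of `k` on the Lie algebra: the derivative at `1` of `x ↦ k x k⁻¹`. Its
values lie in the tangent space at `k * 1 * k⁻¹ = 1`. -/
def Ad (k : K) : GroupLieAlgebra I K →L[ℝ] GroupLieAlgebra I K :=
  mfderiv I I (fun x : K => k * x * k⁻¹) 1

variable (K) in
/-- The (left) Maurer-Cartan form `θ(ξ) = k⁻¹ ξ` for `ξ ∈ T_k K`. Its values lie in the tangent
space at `k⁻¹ * k = 1`. -/
def maurerCartan : OneForm I K (GroupLieAlgebra I K) :=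
  fun k => mfderiv I I (fun x : K => k⁻¹ * x) k

end Forms

/-! ### Principal bundles -/

section Principal

variable {EB : Type*} [NormedAddCommGroup EB] [NormedSpace ℝ EB] {HB : Type*} [TopologicalSpace HB]
  (IB : ModelWithCorners ℝ EB HB)
  {ER : Type*} [NormedAddCommGroup ER] [NormedSpace ℝ ER] {HR : Type*} [TopologicalSpace HR]
  (IR : ModelWithCorners ℝ ER HR)
  {EX : Type*} [NormedAddCommGroup EX] [NormedSpace ℝ EX] {HX : Type*} [TopologicalSpace HX]
  (IX : ModelWithCorners ℝ EX HX)
  {B : Type*} [TopologicalSpace B] [ChartedSpace HB B] [Group B]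
  {R : Type*} [TopologicalSpace R] [ChartedSpace HR R]
  {X : Type*} [TopologicalSpace X] [ChartedSpace HX X]

/-- `proj : R → X` with the right action `act r b = r b` of `B` on `R` is a smooth principal
`B`-bundle: the action is smooth, preserves the fibres, and over a neighbourhood of every point of
the base there is a `B`-equivariant diffeomorphism from `R` to the trivial bundle. -/
structure IsPrincipalBundle (proj : R → X) (act : R → B → R) : Prop where
  act_one : ∀ r, act r 1 = r
  act_mul : ∀ r b b', act r (b * b') = act (act r b) b'
  contMDiff_act : ContMDiff (IR.prod IB) IR ∞ (fun p : R × B => act p.1 p.2)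
  contMDiff_proj : ContMDiff IR IX ∞ proj
  proj_act : ∀ r b, proj (act r b) = proj r
  locally_trivial : ∀ x : X, ∃ e : Bundle.Trivialization B proj, x ∈ e.baseSet ∧
    ContMDiffOn IR (IX.prod IB) ∞ e e.source ∧
    ContMDiffOn (IX.prod IB) IR ∞ e.toOpenPartialHomeomorph.symm e.target ∧
    ∀ r ∈ e.source, ∀ b, (e (act r b)).2 = (e r).2 * b

/-- The fibre product `R ×_X R`, with the subspace topology from `R × R`. -/
abbrev FibreProduct (proj : R → X) : Type _ := {p : R × R // proj p.1 = proj p.2}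

namespace IsPrincipalBundle

variable {IB IR IX} {proj : R → X} {act : R → B → R}

/-- In a trivialization, points of one fibre differ by a unique group element. -/
theorem act_eq_iff (h : IsPrincipalBundle IB IR IX proj act) {e : Bundle.Trivialization B proj}
    (he : ∀ r ∈ e.source, ∀ b, (e (act r b)).2 = (e r).2 * b) {r r' : R}
    (hr : proj r ∈ e.baseSet) (hrr' : proj r = proj r') (b : B) :
    act r b = r' ↔ b = (e r).2⁻¹ * (e r').2 := by
  have hs : r ∈ e.source := e.mem_source.2 hr
  have hs' : r' ∈ e.source := e.mem_source.2 (hrr' ▸ hr)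
  have hsb : act r b ∈ e.source := e.mem_source.2 (by rw [h.proj_act]; exact hr)
  constructor
  · rintro rfl
    rw [he r hs]; group
  · intro hb
    apply e.injOn hsb hs'
    refine Prod.ext ?_ ?_
    · exact (e.coe_fst hsb).trans ((h.proj_act r b).trans (hrr'.trans (e.coe_fst hs').symm))
    · refine (he r hs b).trans ?_
      rw [hb, mul_inv_cancel_left]
      rfl

theorem existsUnique_act (h : IsPrincipalBundle IB IR IX proj act) (z : FibreProduct proj) :
    ∃! b, act z.1.1 b = z.1.2 := by
  obtain ⟨e, hx, -, -, he⟩ := h.locally_trivial (proj z.1.1)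
  refine ⟨(e z.1.1).2⁻¹ * (e z.1.2).2, (h.act_eq_iff he hx z.2 _).2 rfl, fun b hb => ?_⟩
  exact (h.act_eq_iff he hx z.2 _).1 hb

/-- The difference map `ψ : R ×_X R → B` with `r₁ ψ(r₁, r₂) = r₂`. -/
def diffMap (h : IsPrincipalBundle IB IR IX proj act) (z : FibreProduct proj) : B :=
  (h.existsUnique_act z).choose

theorem act_diffMap (h : IsPrincipalBundle IB IR IX proj act) (z : FibreProduct proj) :
    act z.1.1 (h.diffMap z) = z.1.2 :=
  (h.existsUnique_act z).choose_spec.1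

theorem diffMap_eq (h : IsPrincipalBundle IB IR IX proj act) {z : FibreProduct proj} {b : B}
    (hb : act z.1.1 b = z.1.2) : h.diffMap z = b :=
  (h.existsUnique_act z).unique (h.act_diffMap z) hb

/-- The difference map is smooth along smooth pairs of maps into the fibre product. -/
theorem contMDiffAt_diffMap_comp [LieGroup IB ∞ B] (h : IsPrincipalBundle IB IR IX proj act)
    {EN : Type*} [NormedAddCommGroup EN] [NormedSpace ℝ EN] {HN : Type*} [TopologicalSpace HN]
    {IN : ModelWithCorners ℝ EN HN} {N : Type*} [TopologicalSpace N] [ChartedSpace HN N]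
    {f : N → FibreProduct proj} (hf : ContMDiff IN (IR.prod IR) ∞ (fun y => (f y).1)) (y : N) :
    ContMDiffAt IN IB ∞ (fun y => h.diffMap (f y)) y := by
  obtain ⟨e, hx, hsm, -, he⟩ := h.locally_trivial (proj (f y).1.1)
  have h1 : ContMDiff IN IR ∞ (fun y => (f y).1.1) := contMDiff_fst.comp hf
  have h2 : ContMDiff IN IR ∞ (fun y => (f y).1.2) := contMDiff_snd.comp hf
  have hsrc1 : (f y).1.1 ∈ e.source := e.mem_source.2 hx
  have hsrc2 : (f y).1.2 ∈ e.source := e.mem_source.2 ((f y).2 ▸ hx)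
  have g1 : ContMDiffAt IN (IX.prod IB) ∞ (fun y => e (f y).1.1) y :=
    (hsm.contMDiffAt (e.open_source.mem_nhds hsrc1)).comp y h1.contMDiffAt
  have g2 : ContMDiffAt IN (IX.prod IB) ∞ (fun y => e (f y).1.2) y :=
    (hsm.contMDiffAt (e.open_source.mem_nhds hsrc2)).comp y h2.contMDiffAt
  have k1 : ContMDiffAt IN IB ∞ (fun y => (e (f y).1.1).2) y := contMDiffAt_snd.comp y g1
  have k2 : ContMDiffAt IN IB ∞ (fun y => (e (f y).1.2).2) y := contMDiffAt_snd.comp y g2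
  refine (k1.inv.mul k2).congr_of_eventuallyEq ?_
  have hev : ∀ᶠ y' in nhds y, (f y').1.1 ∈ e.source :=
    h1.continuous.continuousAt.eventually (e.open_source.mem_nhds hsrc1)
  filter_upwards [hev] with y' hy'
  exact (h.act_eq_iff he (e.mem_source.1 hy') (f y').2 _).1 (h.act_diffMap (f y'))

theorem continuous_diffMap [LieGroup IB ∞ B] (h : IsPrincipalBundle IB IR IX proj act) :
    Continuous h.diffMap := by
  have : IsTopologicalGroup B := topologicalGroup_of_lieGroup IB ∞
  rw [continuous_iff_continuousAt]
  intro z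
  obtain ⟨e, hx, -, -, he⟩ := h.locally_trivial (proj z.1.1)
  have h1 : Continuous (fun z : FibreProduct proj => z.1.1) := by fun_prop
  have h2 : Continuous (fun z : FibreProduct proj => z.1.2) := by fun_prop
  have hsrc1 : z.1.1 ∈ e.source := e.mem_source.2 hx
  have hsrc2 : z.1.2 ∈ e.source := e.mem_source.2 (z.2 ▸ hx)
  have g1 : ContinuousAt (fun z : FibreProduct proj => e z.1.1) z :=
    ContinuousAt.comp (f := fun z : FibreProduct proj => z.1.1) (e.continuousAt hsrc1)
      h1.continuousAt
  have g2 : ContinuousAt (fun z : FibreProduct proj => e z.1.2) z :=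
    ContinuousAt.comp (f := fun z : FibreProduct proj => z.1.2) (e.continuousAt hsrc2)
      h2.continuousAt
  refine (g1.snd.inv.mul g2.snd).congr ?_
  have hev : ∀ᶠ z' in nhds z, z'.1.1 ∈ e.source :=
    h1.continuousAt.eventually (e.open_source.mem_nhds hsrc1)
  filter_upwards [hev] with z' hz'
  exact ((h.act_eq_iff he (e.mem_source.1 hz') z'.2 _).1 (h.act_diffMap z')).symm

/-- The homeomorphism `R × B → R ×_X R`, `(r, b) ↦ (r, r b)`. -/
def homeomorphFibreProduct [LieGroup IB ∞ B] (h : IsPrincipalBundle IB IR IX proj act) :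
    R × B ≃ₜ FibreProduct proj where
  toFun p := ⟨(p.1, act p.1 p.2), (h.proj_act p.1 p.2).symm⟩
  invFun z := (z.1.1, h.diffMap z)
  left_inv p := Prod.ext rfl (h.diffMap_eq rfl)
  right_inv z := Subtype.ext (Prod.ext rfl (h.act_diffMap z))
  continuous_toFun :=
    (continuous_fst.prodMk h.contMDiff_act.continuous).subtype_mk _
  continuous_invFun := by
    have h1 : Continuous (fun z : FibreProduct proj => z.1.1) := by fun_prop
    exact h1.prodMk h.continuous_diffMap

/-- The manifold structure of `R ×_X R`. It is given by the charts for which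
`(r, b) ↦ (r, r b)` is a diffeomorphism from `R × B`; by `contMDiff_fibreProduct_iff` below, it is
the one induced from `R × R`, so that `R ×_X R` is the fibre product in smooth manifolds. -/
@[reducible]
def chartedSpaceFibreProduct [LieGroup IB ∞ B] (h : IsPrincipalBundle IB IR IX proj act) :
    ChartedSpace (ModelProd HR HB) (FibreProduct proj) where
  atlas := {c | ∃ e ∈ atlas (ModelProd HR HB) (R × B),
    c = h.homeomorphFibreProduct.symm.toOpenPartialHomeomorph ≫ₕ e}
  chartAt z := h.homeomorphFibreProduct.symm.toOpenPartialHomeomorph ≫ₕ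
    chartAt (ModelProd HR HB) (h.homeomorphFibreProduct.symm z)
  mem_chart_source z := by simp
  chart_mem_atlas z := ⟨_, chart_mem_atlas _ _, rfl⟩

theorem isManifold_fibreProduct [LieGroup IB ∞ B] [IsManifold IR ∞ R]
    (h : IsPrincipalBundle IB IR IX proj act) :
    letI := h.chartedSpaceFibreProduct
    IsManifold (IR.prod IB) ∞ (FibreProduct proj) := by
  let _ := h.chartedSpaceFibreProduct
  have : HasGroupoid (FibreProduct proj) (contDiffGroupoid ∞ (IR.prod IB)) := by
    refine ⟨?_⟩
    rintro _ _ ⟨e, he, rfl⟩ ⟨e', he', rfl⟩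
    have hc := HasGroupoid.compatible (G := contDiffGroupoid ∞ (IR.prod IB)) he he'
    refine (contDiffGroupoid ∞ (IR.prod IB)).mem_of_eqOnSource hc ?_
    have h1 : h.homeomorphFibreProduct.symm.toOpenPartialHomeomorph.symm ≫ₕ
        h.homeomorphFibreProduct.symm.toOpenPartialHomeomorph =
        OpenPartialHomeomorph.refl (R × B) := by
      rw [← Homeomorph.symm_toOpenPartialHomeomorph, ← Homeomorph.trans_toOpenPartialHomeomorph,
        Homeomorph.symm_trans_self, Homeomorph.refl_toOpenPartialHomeomorph]
    rw [OpenPartialHomeomorph.trans_symm_eq_symm_trans_symm, OpenPartialHomeomorph.trans_assoc,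
      ← OpenPartialHomeomorph.trans_assoc _ _ e', h1, OpenPartialHomeomorph.refl_trans]
  exact IsManifold.mk' _ _ _

theorem contMDiff_homeomorphFibreProduct_symm [LieGroup IB ∞ B]
    (h : IsPrincipalBundle IB IR IX proj act) :
    letI := h.chartedSpaceFibreProduct
    ContMDiff (IR.prod IB) (IR.prod IB) ∞ h.homeomorphFibreProduct.symm := by
  let _ := h.chartedSpaceFibreProduct
  intro z
  rw [contMDiffAt_iff]
  refine ⟨h.homeomorphFibreProduct.symm.continuous.continuousAt, ?_⟩
  have := (contMDiffAt_iff.1 (contMDiffAt_id (I := IR.prod IB) (n := ∞)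
    (x := h.homeomorphFibreProduct.symm z))).2
  convert this using 1
  · funext u
    exact congrArg (extChartAt (IR.prod IB) (h.homeomorphFibreProduct.symm z))
      (h.homeomorphFibreProduct.symm_apply_apply _)
  · rfl

theorem contMDiff_homeomorphFibreProduct [LieGroup IB ∞ B]
    (h : IsPrincipalBundle IB IR IX proj act) :
    letI := h.chartedSpaceFibreProduct
    ContMDiff (IR.prod IB) (IR.prod IB) ∞ h.homeomorphFibreProduct := by
  let _ := h.chartedSpaceFibreProduct
  intro p
  rw [contMDiffAt_iff]
  refine ⟨h.homeomorphFibreProduct.continuous.continuousAt, ?_⟩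
  have := (contMDiffAt_iff.1 (contMDiffAt_id (I := IR.prod IB) (n := ∞)
    (x := p))).2
  convert this using 1
  funext u
  have h1 : ∀ z z' : FibreProduct proj, extChartAt (IR.prod IB) z z' =
    extChartAt (IR.prod IB) (h.homeomorphFibreProduct.symm z)
      (h.homeomorphFibreProduct.symm z') := fun _ _ => rfl
  simp only [Function.comp_apply, h1, h.homeomorphFibreProduct.symm_apply_apply, id]

/-- A map into `R ×_X R` is smooth if and only if it is smooth as a map into `R × R`. -/
theorem contMDiff_fibreProduct_iff [LieGroup IB ∞ B]
    (h : IsPrincipalBundle IB IR IX proj act)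
    {EN : Type*} [NormedAddCommGroup EN] [NormedSpace ℝ EN] {HN : Type*} [TopologicalSpace HN]
    {IN : ModelWithCorners ℝ EN HN} {N : Type*} [TopologicalSpace N] [ChartedSpace HN N]
    (f : N → FibreProduct proj) :
    letI := h.chartedSpaceFibreProduct
    ContMDiff IN (IR.prod IB) ∞ f ↔ ContMDiff IN (IR.prod IR) ∞ (fun y => (f y).1) := by
  let _ := h.chartedSpaceFibreProduct
  constructor
  · intro hf
    have h1 : ContMDiff IN (IR.prod IB) ∞ (fun y => h.homeomorphFibreProduct.symm (f y)) :=
      h.contMDiff_homeomorphFibreProduct_symm.comp hf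
    have h2 : ContMDiff IN IR ∞ (fun y => (f y).1.1) :=
      (contMDiff_fst (I := IR) (J := IB) (M := R) (N := B)).comp h1
    have h3 : ContMDiff IN IR ∞ (fun y => (f y).1.2) := by
      have h4 := h.contMDiff_act.comp h1
      refine h4.congr fun y => ?_
      exact (h.act_diffMap (f y)).symm
    exact h2.prodMk h3
  · intro hf
    have h1 : ContMDiff IN IB ∞ (fun y => h.diffMap (f y)) :=
      fun y => h.contMDiffAt_diffMap_comp hf y
    have h2 : ContMDiff IN IR ∞ (fun y => (f y).1.1) := contMDiff_fst.comp hf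
    have h3 := h.contMDiff_homeomorphFibreProduct.comp (h2.prodMk h1)
    refine h3.congr fun y => ?_
    exact (h.homeomorphFibreProduct.apply_symm_apply (f y)).symm

end IsPrincipalBundle

/-! ### Equivariant bundles and connections -/

variable {EG : Type*} [NormedAddCommGroup EG] [NormedSpace ℝ EG] {HG : Type*} [TopologicalSpace HG]
  (IG : ModelWithCorners ℝ EG HG)
  (G : Type*) [TopologicalSpace G] [ChartedSpace HG G] [Group G]

/-- `proj : R → X` is a `G`-equivariant principal `B`-bundle: a principal `B`-bundle for which the
actions of `G` from the left on `R` and `X` are smooth and compatible with the bundle. -/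
structure IsEquivariantPrincipalBundle [MulAction G R] [MulAction G X]
    (proj : R → X) (act : R → B → R) : Prop
    extends IsPrincipalBundle IB IR IX proj act where
  contMDiffSMul : ContMDiffSMul IG IR ∞ G R
  contMDiffSMul_base : ContMDiffSMul IG IX ∞ G X
  smul_act : ∀ (g : G) r b, g • act r b = act (g • r) b
  proj_smul : ∀ (g : G) r, proj (g • r) = g • proj r

/-- `η` is a connection `1`-form for the right action of the structure group `B` on the total
space `R` of a principal bundle: it is smooth, `η(r ξ) = ξ` for `ξ` in the Lie algebra of `B`, and
`η(v b) = b⁻¹ η(v) b`. (The vector `r ξ` is computed in the tangent space at `r 1 = r`.) -/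
structure IsConnection [IsManifold IR ∞ R] (act : R → B → R)
    (η : OneForm IR R (GroupLieAlgebra IB B)) : Prop where
  smooth : η.IsSmooth
  vertical : ∀ r (ξ : GroupLieAlgebra IB B), η (act r 1) (mfderiv IB IR (act r) 1 ξ) = ξ
  equivariant : ∀ r b (v : TangentSpace IR r),
    η (act r b) (mfderiv IR IR (fun r' => act r' b) r v) = Ad IB b⁻¹ (η r v)

/-- The space of `G`-connections: connection `1`-forms `η` with `g^* η = η` for all `g ∈ G`. -/
def equivariantConnections [IsManifold IR ∞ R] [MulAction G R] (act : R → B → R) :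
    Set (OneForm IR R (GroupLieAlgebra IB B)) :=
  {η | IsConnection IB IR act η ∧ ∀ g : G, η.pullback (fun r : R => g • r) = η}

end Principal

/-! ### Central extensions -/

section Central

variable {EA : Type*} [NormedAddCommGroup EA] [NormedSpace ℝ EA] {HA : Type*} [TopologicalSpace HA]
  (IA : ModelWithCorners ℝ EA HA)
  {EB : Type*} [NormedAddCommGroup EB] [NormedSpace ℝ EB] {HB : Type*} [TopologicalSpace HB]
  (IB : ModelWithCorners ℝ EB HB)
  {EC : Type*} [NormedAddCommGroup EC] [NormedSpace ℝ EC] {HC : Type*} [TopologicalSpace HC]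
  (IC : ModelWithCorners ℝ EC HC)
  {A : Type*} [TopologicalSpace A] [ChartedSpace HA A] [Group A]
  {B : Type*} [TopologicalSpace B] [ChartedSpace HB B] [Group B]
  {C : Type*} [TopologicalSpace C] [ChartedSpace HC C] [Group C]

/-- `1 → A → B → C → 1` is a central extension of Lie groups: an exact sequence of smooth
homomorphisms with `A` central in `B`, for which `β : B → C` is a principal `A`-bundle (which is
automatic for exact sequences of finite-dimensional second countable Lie groups). -/
structure IsLieCentralExtension (α : A →* B) (β : B →* C) : Prop where
  contMDiff_left : ContMDiff IA IB ∞ α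
  contMDiff_right : ContMDiff IB IC ∞ β
  injective : Function.Injective α
  exact : α.range = β.ker
  surjective : Function.Surjective β
  central : ∀ a b, α a * b = b * α a
  isPrincipalBundle : IsPrincipalBundle IA IB IC β (fun b a => b * α a)

/-- `(s, t)` is an `Ad|_B`-equivariant splitting of `0 → 𝔞 → 𝔟 → 𝔠 → 0`: the linear map `s` is a
`B`-equivariant section of `β_*`, and `t` is the complementary projection, characterized by
`1 = α_* t + s β_*`. -/
structure IsEquivariantSplitting (α : A →* B) (β : B →* C)
    (s : GroupLieAlgebra IC C →L[ℝ] GroupLieAlgebra IB B)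
    (t : GroupLieAlgebra IB B →L[ℝ] GroupLieAlgebra IA A) : Prop where
  section_right : ∀ ξ, lieMap IB IC β (s ξ) = ξ
  section_equivariant : ∀ b ξ, s (Ad IC (β b) ξ) = Ad IB b (s ξ)
  decomposition : ∀ ξ, lieMap IA IB α (t ξ) + s (lieMap IB IC β ξ) = ξ

variable {EG : Type*} [NormedAddCommGroup EG] [NormedSpace ℝ EG] {HG : Type*} [TopologicalSpace HG]
  (IG : ModelWithCorners ℝ EG HG)
  {ER : Type*} [NormedAddCommGroup ER] [NormedSpace ℝ ER] {HR : Type*} [TopologicalSpace HR]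
  (IR : ModelWithCorners ℝ ER HR)
  {EP : Type*} [NormedAddCommGroup EP] [NormedSpace ℝ EP] {HP : Type*} [TopologicalSpace HP]
  (IP : ModelWithCorners ℝ EP HP)
  {EX : Type*} [NormedAddCommGroup EX] [NormedSpace ℝ EX] {HX : Type*} [TopologicalSpace HX]
  (IX : ModelWithCorners ℝ EX HX)
  (G : Type*) [TopologicalSpace G] [ChartedSpace HG G] [Group G]
  {R : Type*} [TopologicalSpace R] [ChartedSpace HR R]
  {P : Type*} [TopologicalSpace P] [ChartedSpace HP P]
  {X : Type*} [TopologicalSpace X] [ChartedSpace HX X]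

/-- `ρ : R → P → X` (maps `σ` and `π`) is a `G`-equivariant central extension, along `β : B → C`,
of the `G`-equivariant principal `C`-bundle `π : P → X`: the composite `ρ = π ∘ σ` is a
`G`-equivariant principal `B`-bundle, and `σ` is a smooth `G`-equivariant homomorphism of bundles
over `X` along `β`. -/
structure IsEquivariantCentralExtension [MulAction G R] [MulAction G P] [MulAction G X]
    (β : B →* C) (ρ : R → X) (σ : R → P) (π : P → X)
    (actR : R → B → R) (actP : P → C → P) : Prop where
  bundle_base : IsEquivariantPrincipalBundle IC IP IX IG G π actP
  bundle_total : IsEquivariantPrincipalBundle IB IR IX IG G ρ actR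
  contMDiff : ContMDiff IR IP ∞ σ
  proj_map : ∀ r, π (σ r) = ρ r
  map_act : ∀ r b, σ (actR r b) = actP (σ r) (β b)
  map_smul : ∀ (g : G) r, σ (g • r) = g • σ r

/-- The right action of `A` on `R` obtained from the action of `B` along `α : A → B`. For a central
extension it makes `σ : R → P` an `A`-bundle. -/
def restrictAct (α : A →* B) (actR : R → B → R) : R → A → R :=
  fun r a => actR r (α a)

variable {IA IB IC IR IP IX}

/-- The equation `pr₂^* η - pr₁^* η = ψ^* t(θ_B)` of `𝔞`-valued `1`-forms on `R ×_X R`, where `ψ`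
is the difference map of the principal `B`-bundle `ρ : R → X`. -/
def DifferenceEquation [LieGroup IB ∞ B] {ρ : R → X} {actR : R → B → R}
    (h : IsPrincipalBundle IB IR IX ρ actR)
    (t : GroupLieAlgebra IB B →L[ℝ] GroupLieAlgebra IA A)
    (η : OneForm IR R (GroupLieAlgebra IA A)) : Prop :=
  letI := h.chartedSpaceFibreProduct
  (η.pullback (fun z : FibreProduct ρ => z.1.2) - η.pullback (fun z : FibreProduct ρ => z.1.1) :
    OneForm (IR.prod IB) (FibreProduct ρ) (GroupLieAlgebra IA A)) =
  ((maurerCartan IB B).map t).pullback h.diffMap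

/-- The `𝔟`-valued `1`-form `α_* ω^σ + s (σ^* ω^π)` on `R` given by a pair `(ω^σ, ω^π)` of an
`𝔞`-valued `1`-form on `R` and a `𝔠`-valued `1`-form on `P`. -/
def formOfPair (α : A →* B) (s : GroupLieAlgebra IC C →L[ℝ] GroupLieAlgebra IB B) (σ : R → P)
    (q : OneForm IR R (GroupLieAlgebra IA A) × OneForm IP P (GroupLieAlgebra IC C)) :
    OneForm IR R (GroupLieAlgebra IB B) :=
  q.1.map (lieMap IA IB α) + (q.2.pullback σ).map s

end Central

end CentralExt

end

/-!
The splitting `(s, t)` identifies `𝔟` with `𝔞 ⊕ 𝔠`, compatibly with `Ad` of `B`, which acts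
trivially on `𝔞` and through `β` on `𝔠`. Hence a connection form `η` on `ρ` decomposes as
`η = α_* (t η) + s (β_* η)`, and the two components have to be characterized.

* The `𝔞`-component. A connection form satisfies the Leibniz rule
  `(f b)^* η = Ad_{b⁻¹} f^* η + b^* θ` (`IsConnection.pullback_act`). On `R ×_X R ≅ R × B` it says
  that `t η` solves the difference equation, since `t` is `Ad`-invariant. Conversely, a solution of
  the difference equation is invariant under right translation by `B` and takes the value `t ξ` on
  the fundamental vector field of `ξ ∈ 𝔟` (`DifferenceEquation.pullback_act_right`,
  `DifferenceEquation.pullback_act_left`), and this is all that is needed for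
  `α_* ω^σ + s (σ^* ω^π)` to be a connection on `ρ`.
* The `𝔠`-component. The map `σ` has smooth local sections, so `σ^*` is injective on forms
  (`HasLocalSections.pullback_injective`). A local map `R → R` over `P` has the form `r ↦ r b(r)`
  with `β(b(r)) = 1`, and by the Leibniz rule it leaves `β_* η` invariant. Hence `β_* η` is the
  pullback of a unique form on `P`, given by `τ^* (β_* η)` for any local section `τ`
  (`HasLocalSections.exists_pullback_eq`). It inherits the properties of a connection from `η`,
  because these can be checked after applying `σ^*` (`exists_pullback_eq_map_lieMap`).
-/

open scoped Manifold ContDiff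

noncomputable section

namespace CentralExt

/-! ### Calculus of one-forms -/

section Forms

variable {E : Type*} [NormedAddCommGroup E] [NormedSpace ℝ E] {H : Type*} [TopologicalSpace H]
  {I : ModelWithCorners ℝ E H} {M : Type*} [TopologicalSpace M] [ChartedSpace H M]
  {E' : Type*} [NormedAddCommGroup E'] [NormedSpace ℝ E'] {H' : Type*} [TopologicalSpace H']
  {I' : ModelWithCorners ℝ E' H'} {N : Type*} [TopologicalSpace N] [ChartedSpace H' N]
  {E'' : Type*} [NormedAddCommGroup E''] [NormedSpace ℝ E''] {H'' : Type*} [TopologicalSpace H'']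
  {I'' : ModelWithCorners ℝ E'' H''} {N' : Type*} [TopologicalSpace N'] [ChartedSpace H'' N']
  {V : Type*} [TopologicalSpace V] [AddCommGroup V] [Module ℝ V]
  {W : Type*} [TopologicalSpace W] [AddCommGroup W] [Module ℝ W]

namespace OneForm

theorem pullback_id (η : OneForm I M V) : η.pullback (fun x : M => x) = η := by
  funext x
  have h : mfderiv I I (fun x : M => x) x = ContinuousLinearMap.id ℝ _ := mfderiv_id
  ext v
  simp only [pullback, ContinuousLinearMap.comp_apply, h, ContinuousLinearMap.id_apply]

/-- The chain rule. Stated for pullbacks, it avoids comparing tangent spaces at basepoints that are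
only propositionally equal, since both sides take values in `V`. -/
theorem pullback_comp_apply (η : OneForm I M V) {g : N → M} {f : N' → N} (x : N')
    (hg : MDifferentiableAt I' I g (f x)) (hf : MDifferentiableAt I'' I' f x)
    (v : TangentSpace I'' x) :
    η.pullback (fun y => g (f y)) x v = η.pullback g (f x) (mfderiv I'' I' f x v) := by
  have h := mfderiv_comp_apply x hg hf v
  exact congrArg (η (g (f x))) h

theorem pullback_pullback (η : OneForm I M V) {g : N → M} {f : N' → N}
    (hg : MDifferentiable I' I g) (hf : MDifferentiable I'' I' f) :
    ((η.pullback g : OneForm I' N V).pullback f : OneForm I'' N' V) =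
      η.pullback (fun y => g (f y)) := by
  funext x
  ext v
  exact (η.pullback_comp_apply x (hg _) (hf x) v).symm

theorem pullback_congr (η : OneForm I M V) {f g : N → M} {x : N} (h : f =ᶠ[nhds x] g) :
    (η.pullback f : OneForm I' N V) x = η.pullback g x := by
  -- `f x` and `g x` are only propositionally equal: work in the model space `E`, which is the
  -- tangent space at every point
  have key : ∀ p q : M, p = q → ∀ L : E' →L[ℝ] E,
      (show E →L[ℝ] V from η p).comp L = (show E →L[ℝ] V from η q).comp L := by
    rintro p _ rfl L; rfl
  have h1 : (show E' →L[ℝ] E from mfderiv I' I f x) = mfderiv I' I g x := h.mfderiv_eq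
  have h2 := key _ _ h.eq_of_nhds (mfderiv I' I f x)
  refine h2.trans ?_
  exact congrArg (fun L : E' →L[ℝ] E => (show E →L[ℝ] V from η (g x)).comp L) h1

theorem map_pullback (L : V →L[ℝ] W) (η : OneForm I M V) (f : N → M) :
    ((η.map L).pullback f : OneForm I' N W) = (η.pullback f).map L := rfl

/-- The pullback of a form under `y ↦ F (f y, g y)` is the sum of the contributions of the two
arguments of `F`. -/
theorem pullback_prod_apply (η : OneForm I M V)
    {E₁ : Type*} [NormedAddCommGroup E₁] [NormedSpace ℝ E₁] {H₁ : Type*} [TopologicalSpace H₁]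
    {I₁ : ModelWithCorners ℝ E₁ H₁} {N₁ : Type*} [TopologicalSpace N₁] [ChartedSpace H₁ N₁]
    {F : N × N' → M} {f : N₁ → N} {g : N₁ → N'} {y : N₁}
    (hF : MDifferentiableAt (I'.prod I'') I F (f y, g y))
    (hf : MDifferentiableAt I₁ I' f y) (hg : MDifferentiableAt I₁ I'' g y)
    (w : TangentSpace I₁ y) :
    η.pullback (fun y => F (f y, g y)) y w =
      η.pullback (fun x => F (x, g y)) (f y) (mfderiv I₁ I' f y w) +
      η.pullback (fun x => F (f y, x)) (g y) (mfderiv I₁ I'' g y w) := by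
  rw [η.pullback_comp_apply (g := F) (f := fun y => (f y, g y)) y hF (hf.prodMk hg),
    hf.mfderiv_prod hg]
  have h := mfderiv_prod_eq_add_apply
    (v := ((mfderiv I₁ I' f y w, mfderiv I₁ I'' g y w) : E' × E'')) hF
  exact (congrArg (η (F (f y, g y))) h).trans (map_add _ _ _)

variable {K : Type*} [TopologicalSpace K] [ChartedSpace H'' K] [Group K]
  {E₁ : Type*} [NormedAddCommGroup E₁] [NormedSpace ℝ E₁] {H₁ : Type*} [TopologicalSpace H₁]
  {I₁ : ModelWithCorners ℝ E₁ H₁} {L : Type*} [TopologicalSpace L] [ChartedSpace H₁ L] [Group L]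

theorem IsSmooth.add [IsManifold I ∞ M] {η ζ : OneForm I M (GroupLieAlgebra I'' K)}
    (hη : η.IsSmooth) (hζ : ζ.IsSmooth) : (η + ζ).IsSmooth := by
  have h := (ContinuousLinearMap.contMDiff (n := ∞)
    (ContinuousLinearMap.fst ℝ E'' E'' + ContinuousLinearMap.snd ℝ E'' E'')).comp
    (ContMDiff.prodMk_space hη hζ)
  exact h

theorem IsSmooth.map [IsManifold I ∞ M] {η : OneForm I M (GroupLieAlgebra I'' K)}
    (hη : η.IsSmooth) (T : GroupLieAlgebra I'' K →L[ℝ] GroupLieAlgebra I₁ L) :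
    (η.map T).IsSmooth :=
  (ContinuousLinearMap.contMDiff (show E'' →L[ℝ] E₁ from T)).comp hη

theorem IsSmooth.pullback [IsManifold I ∞ M] [IsManifold I' ∞ N]
    {η : OneForm I M (GroupLieAlgebra I'' K)} (hη : η.IsSmooth) {f : N → M}
    (hf : ContMDiff I' I ∞ f) : (η.pullback f : OneForm I' N _).IsSmooth := by
  have : IsManifold I 1 M := .of_le (n := ∞) (by simp)
  have : IsManifold I' 1 N := .of_le (n := ∞) (by simp)
  exact ContMDiff.comp hη (hf.contMDiff_tangentMap (m := ∞) (by simp))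

/-- A form that is locally a pullback of a smooth form along a smooth map is smooth. -/
theorem isSmooth_of_locally_pullback [IsManifold I ∞ M] [IsManifold I' ∞ N]
    {η : OneForm I M (GroupLieAlgebra I'' K)} (hη : η.IsSmooth)
    {ζ : OneForm I' N (GroupLieAlgebra I'' K)}
    (h : ∀ p : N, ∃ U : Set N, IsOpen U ∧ p ∈ U ∧ ∃ f : N → M, ContMDiffOn I' I ∞ f U ∧
      ∀ q ∈ U, ζ q = η.pullback f q) : ζ.IsSmooth := by
  have : IsManifold I 1 M := .of_le (n := ∞) (by simp)
  have : IsManifold I' 1 N := .of_le (n := ∞) (by simp)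
  intro v
  obtain ⟨U, hU, hp, f, hf, hζ⟩ := h v.proj
  have h1 := hf.contMDiffOn_tangentMapWithin (m := ∞) (by simp) hU.uniqueMDiffOn
  have hO : IsOpen (Bundle.TotalSpace.proj ⁻¹' U : Set (TangentBundle I' N)) :=
    hU.preimage (FiberBundle.continuous_proj E' (TangentSpace I'))
  have hmem := hO.mem_nhds (x := v) hp
  have h2 : ContMDiffAt I'.tangent I.tangent ∞ (tangentMapWithin I' I f U) v :=
    (h1 v hp).contMDiffAt hmem
  refine ((ContMDiff.contMDiffAt hη).comp v h2).congr_of_eventuallyEq ?_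
  filter_upwards [hmem] with w hw
  have h3 : mfderivWithin I' I f U w.proj = mfderiv I' I f w.proj :=
    mfderivWithin_of_isOpen hU hw
  simp only [hζ _ hw]
  exact congrArg (fun T : E' →L[ℝ] E => (show E'' from η (f w.proj) (T w.snd))) h3.symm

end OneForm

/-! ### The Maurer-Cartan form and the adjoint action -/

variable {K : Type*} [TopologicalSpace K] [ChartedSpace H K] [Group K]
  {L : Type*} [TopologicalSpace L] [ChartedSpace H' L] [Group L]

theorem maurerCartan_one : maurerCartan I K 1 = ContinuousLinearMap.id ℝ _ := by
  have h : (fun x : K => (1 : K)⁻¹ * x) = id := by funext x; simp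
  unfold maurerCartan
  have h2 : mfderiv I I (fun x : K => (1 : K)⁻¹ * x) 1 = mfderiv I I (id : K → K) 1 :=
    Filter.EventuallyEq.mfderiv_eq (Filter.EventuallyEq.of_eq h)
  exact h2.trans mfderiv_id

theorem mdifferentiableAt_mul_left [LieGroup I ∞ K] (k x : K) :
    MDifferentiableAt I I (fun y : K => k * y) x :=
  (contMDiff_mul_left (n := ∞)).contMDiffAt.mdifferentiableAt (by simp)

theorem mdifferentiableAt_conj [LieGroup I ∞ K] (k x : K) :
    MDifferentiableAt I I (fun y : K => k * y * k⁻¹) x :=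
  ((contMDiff_mul_right (n := ∞) (a := k⁻¹)).comp
    (contMDiff_mul_left (n := ∞) (a := k))).contMDiffAt.mdifferentiableAt (by simp)

/-- The Maurer-Cartan forms are compatible with homomorphisms of Lie groups. -/
theorem lieMap_maurerCartan [LieGroup I ∞ K] [LieGroup I' ∞ L] {f : K →* L}
    (hf : ContMDiff I I' ∞ f) (k : K) (ξ : TangentSpace I k) :
    lieMap I I' f (maurerCartan I K k ξ) = (maurerCartan I' L).pullback f k ξ := by
  have hf' : ∀ x, MDifferentiableAt I I' f x :=
    fun x => hf.contMDiffAt.mdifferentiableAt (by simp)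
  have h1 := mfderiv_comp_apply_of_eq k (hf' 1) (mdifferentiableAt_mul_left (I := I) k⁻¹ k)
    (inv_mul_cancel k) ξ
  have h2 := mfderiv_comp_apply k (mdifferentiableAt_mul_left (I := I') (f k)⁻¹ (f k)) (hf' k) ξ
  have h3 : (f ∘ fun y : K => k⁻¹ * y) = (fun y : L => (f k)⁻¹ * y) ∘ f := by
    funext y; simp
  have h4 : mfderiv I I' (f ∘ fun y : K => k⁻¹ * y) k
      = mfderiv I I' ((fun y : L => (f k)⁻¹ * y) ∘ f) k :=
    Filter.EventuallyEq.mfderiv_eq (Filter.EventuallyEq.of_eq h3)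
  exact h1.symm.trans ((congrArg (fun T : E →L[ℝ] E' => T ξ) h4).trans h2)

theorem lieMap_Ad [LieGroup I ∞ K] [LieGroup I' ∞ L] {f : K →* L}
    (hf : ContMDiff I I' ∞ f) (k : K) (ξ : GroupLieAlgebra I K) :
    lieMap I I' f (Ad I k ξ) = Ad I' (f k) (lieMap I I' f ξ) := by
  have hf' : ∀ x, MDifferentiableAt I I' f x :=
    fun x => hf.contMDiffAt.mdifferentiableAt (by simp)
  have h1 := mfderiv_comp_apply_of_eq 1 (hf' 1) (mdifferentiableAt_conj (I := I) k 1)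
    (by simp) ξ
  have h2 := mfderiv_comp_apply_of_eq 1 (mdifferentiableAt_conj (I := I') (f k) 1) (hf' 1)
    (map_one f) ξ
  have h3 : (f ∘ fun y : K => k * y * k⁻¹) = (fun y : L => f k * y * (f k)⁻¹) ∘ f := by
    funext y; simp
  have h4 : mfderiv I I' (f ∘ fun y : K => k * y * k⁻¹) 1
      = mfderiv I I' ((fun y : L => f k * y * (f k)⁻¹) ∘ f) 1 :=
    Filter.EventuallyEq.mfderiv_eq (Filter.EventuallyEq.of_eq h3)
  exact h1.symm.trans ((congrArg (fun T : E →L[ℝ] E' => T ξ) h4).trans h2)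

theorem Ad_of_central {k : K} (hk : ∀ x, k * x = x * k) :
    Ad I k = ContinuousLinearMap.id ℝ _ := by
  have h : (fun x : K => k * x * k⁻¹) = id := by funext x; simp [hk x]
  have h2 : mfderiv I I (fun x : K => k * x * k⁻¹) 1 = mfderiv I I (id : K → K) 1 :=
    Filter.EventuallyEq.mfderiv_eq (Filter.EventuallyEq.of_eq h)
  exact h2.trans mfderiv_id

/-- A homomorphism with central image maps the Lie algebra to the fixed points of `Ad`. -/
theorem Ad_lieMap_of_central [LieGroup I' ∞ L] {f : K →* L} (hf : ContMDiff I I' ∞ f)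
    (hc : ∀ a b, f a * b = b * f a) (b : L) (ξ : GroupLieAlgebra I K) :
    Ad I' b (lieMap I I' f ξ) = lieMap I I' f ξ := by
  have hf' : ∀ x, MDifferentiableAt I I' f x :=
    fun x => hf.contMDiffAt.mdifferentiableAt (by simp)
  have h2 := mfderiv_comp_apply_of_eq 1 (mdifferentiableAt_conj (I := I') b 1) (hf' 1)
    (map_one f) ξ
  have h3 : (fun y : L => b * y * b⁻¹) ∘ f = f := by
    funext y; simp [← hc]
  have h4 : mfderiv I I' ((fun y : L => b * y * b⁻¹) ∘ f) 1 = mfderiv I I' f 1 :=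
    Filter.EventuallyEq.mfderiv_eq (Filter.EventuallyEq.of_eq h3)
  exact h2.symm.trans (congrArg (fun T : E →L[ℝ] E' => T ξ) h4)

/-- The Maurer-Cartan form of the source, followed by `f_*`, vanishes along a map on which the
homomorphism `f` is locally constant. -/
theorem lieMap_maurerCartan_pullback_eq_zero [LieGroup I ∞ K] [LieGroup I' ∞ L] {f : K →* L}
    (hf : ContMDiff I I' ∞ f) {g : N' → K} {y : N'} (hg : MDifferentiableAt I'' I g y)
    {l : L} (hc : ∀ᶠ z in nhds y, f (g z) = l) (w : TangentSpace I'' y) :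
    lieMap I I' f ((maurerCartan I K).pullback g y w) = 0 := by
  have h1 : lieMap I I' f ((maurerCartan I K).pullback g y w) =
      (maurerCartan I' L).pullback (fun z => f (g z)) y w := by
    rw [(maurerCartan I' L).pullback_comp_apply y
      (hf.contMDiffAt.mdifferentiableAt (by simp)) hg]
    exact lieMap_maurerCartan hf _ _
  rw [h1, OneForm.pullback_congr (g := fun _ => l) _ hc]
  have h2 : mfderiv I'' I' (fun _ : N' => l) y = 0 := mfderiv_const
  exact (congrArg (maurerCartan I' L l) (congrArg (fun T : E'' →L[ℝ] E' => T w) h2)).trans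
    (map_zero _)

end Forms

/-! ### Principal bundles -/

section Bundles

variable {EB : Type*} [NormedAddCommGroup EB] [NormedSpace ℝ EB] {HB : Type*} [TopologicalSpace HB]
  {IB : ModelWithCorners ℝ EB HB}
  {ER : Type*} [NormedAddCommGroup ER] [NormedSpace ℝ ER] {HR : Type*} [TopologicalSpace HR]
  {IR : ModelWithCorners ℝ ER HR}
  {EX : Type*} [NormedAddCommGroup EX] [NormedSpace ℝ EX] {HX : Type*} [TopologicalSpace HX]
  {IX : ModelWithCorners ℝ EX HX}
  {EN : Type*} [NormedAddCommGroup EN] [NormedSpace ℝ EN] {HN : Type*} [TopologicalSpace HN]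
  {IN : ModelWithCorners ℝ EN HN}
  {B : Type*} [TopologicalSpace B] [ChartedSpace HB B] [Group B]
  {R : Type*} [TopologicalSpace R] [ChartedSpace HR R]
  {X : Type*} [TopologicalSpace X] [ChartedSpace HX X]
  {N : Type*} [TopologicalSpace N] [ChartedSpace HN N]
  {V : Type*} [TopologicalSpace V] [AddCommGroup V] [Module ℝ V]
  {proj : R → X} {act : R → B → R}

variable (IR IX) in
/-- The map `proj` has a smooth local section near every point of its target. -/
def HasLocalSections (proj : R → X) : Prop :=
  ∀ x : X, ∃ U : Set X, IsOpen U ∧ x ∈ U ∧ ∃ τ : X → R, ContMDiffOn IX IR ∞ τ U ∧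
    ∀ y ∈ U, proj (τ y) = y

theorem HasLocalSections.surjective (h : HasLocalSections IR IX proj) :
    Function.Surjective proj := fun x =>
  let ⟨_, _, hx, τ, _, hτ⟩ := h x
  ⟨τ x, hτ x hx⟩

/-- Pullback of forms along a smooth map with local sections is injective. -/
theorem HasLocalSections.pullback_injective (h : HasLocalSections IR IX proj)
    (hp : ContMDiff IR IX ∞ proj) {η ζ : OneForm IX X V}
    (heq : (η.pullback proj : OneForm IR R V) = ζ.pullback proj) : η = ζ := by
  funext x
  obtain ⟨U, hU, hx, τ, hτ, hs⟩ := h x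
  have hτx : MDifferentiableAt IX IR τ x :=
    (hτ.contMDiffAt (hU.mem_nhds hx)).mdifferentiableAt (by simp)
  have hp' := fun r => (hp.contMDiffAt (x := r)).mdifferentiableAt (n := ∞) (by simp)
  have key : ∀ (κ : OneForm IX X V) (v : TangentSpace IX x),
      κ x v = κ.pullback proj (τ x) (mfderiv IX IR τ x v) := by
    intro κ v
    rw [← κ.pullback_comp_apply x (hp' _) hτx, κ.pullback_congr (g := fun y => y),
      κ.pullback_id]
    filter_upwards [hU.mem_nhds hx] with y hy using hs y hy
  ext v
  rw [key η, key ζ, heq]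

/-- Descent of forms: a form `η` on `R` which is invariant under all local smooth maps over `X`
is the pullback of a form on `X`, namely of the one given by `τ^* η` for any local section `τ`. -/
theorem HasLocalSections.exists_pullback_eq {K : Type*} [TopologicalSpace K] [ChartedSpace HB K]
    [Group K] [IsManifold IR ∞ R] [IsManifold IX ∞ X]
    (h : HasLocalSections IR IX proj) (hp : ContMDiff IR IX ∞ proj)
    {η : OneForm IR R (GroupLieAlgebra IB K)} (hη : η.IsSmooth)
    (hinv : ∀ (U : Set R) (g : R → R), IsOpen U → ContMDiffOn IR IR ∞ g U →
      (∀ r ∈ U, proj (g r) = proj r) → ∀ r ∈ U, η.pullback g r = η r) :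
    ∃ κ : OneForm IX X (GroupLieAlgebra IB K), κ.IsSmooth ∧ κ.pullback proj = η := by
  choose U hU hx τ hτ hs using h
  have hp' := fun r => (hp.contMDiffAt (x := r)).mdifferentiableAt (n := ∞) (by simp)
  have hτ' : ∀ x, ∀ y ∈ U x, MDifferentiableAt IX IR (τ x) y := fun x y hy =>
    ((hτ x).contMDiffAt ((hU x).mem_nhds hy)).mdifferentiableAt (by simp)
  -- apply the invariance of `η` to the local map `τ x ∘ proj` over `X`
  have key : ∀ x r (v : TangentSpace IR r), proj r ∈ U x →
      η.pullback (τ x) (proj r) (mfderiv IR IX proj r v) = η r v := by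
    intro x r v hr
    have hO : IsOpen (proj ⁻¹' U x) := (hU x).preimage hp.continuous
    rw [← hinv (proj ⁻¹' U x) (fun r => τ x (proj r)) hO
      ((hτ x).comp hp.contMDiffOn fun _ hr => hr) (fun r hr => hs x _ hr) r hr]
    exact (η.pullback_comp_apply r (hτ' x _ hr) (hp' r) v).symm
  let κ : OneForm IX X (GroupLieAlgebra IB K) := fun x => η.pullback (τ x) x
  have hκ : κ.pullback proj = η := by
    funext r
    ext v
    exact key (proj r) r v (hx _)
  refine ⟨κ, OneForm.isSmooth_of_locally_pullback hη fun x =>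
    ⟨U x, hU x, hx x, τ x, hτ x, fun y hy => ?_⟩, hκ⟩
  -- `proj^* κ = η` shows that `κ` is `τ^* η` for every local section `τ`, on its whole domain
  ext v
  have h1 : κ.pullback (fun z => proj (τ x z)) y v = κ y v := by
    rw [κ.pullback_congr (g := fun y => y), κ.pullback_id]
    filter_upwards [(hU x).mem_nhds hy] with z hz using hs x z hz
  rw [← h1, κ.pullback_comp_apply y (hp' _) (hτ' x y hy), hκ]
  rfl

namespace IsPrincipalBundle

theorem hasLocalSections (h : IsPrincipalBundle IB IR IX proj act) :
    HasLocalSections IR IX proj := by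
  intro x
  obtain ⟨e, hx, -, hsymm, -⟩ := h.locally_trivial x
  have hmem : ∀ y ∈ e.baseSet, ((y, 1) : X × B) ∈ e.target := fun y hy => e.mem_target.2 hy
  refine ⟨e.baseSet, e.open_baseSet, hx, fun y => e.toOpenPartialHomeomorph.symm (y, 1),
    hsymm.comp (contMDiff_id.prodMk contMDiff_const).contMDiffOn hmem, fun y hy => ?_⟩
  exact e.proj_symm_apply (hmem y hy)

theorem eq_one_of_act_eq (h : IsPrincipalBundle IB IR IX proj act) {r : R} {b : B}
    (hb : act r b = r) : b = 1 :=
  (h.existsUnique_act ⟨(r, r), rfl⟩).unique hb (h.act_one r)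

/-- Two smooth local maps into the total space over the same map into the base differ by a smooth
local map into the structure group. -/
theorem exists_contMDiffOn_act_eq [LieGroup IB ∞ B] (h : IsPrincipalBundle IB IR IX proj act)
    {U : Set N} (hU : IsOpen U) {f g : N → R} (hf : ContMDiffOn IN IR ∞ f U)
    (hg : ContMDiffOn IN IR ∞ g U) (hfg : ∀ z ∈ U, proj (f z) = proj (g z)) {y : N} (hy : y ∈ U) :
    ∃ U' ⊆ U, IsOpen U' ∧ y ∈ U' ∧ ∃ b : N → B, ContMDiffOn IN IB ∞ b U' ∧
      ∀ z ∈ U', act (f z) (b z) = g z := by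
  obtain ⟨e, hx, hsm, -, he⟩ := h.locally_trivial (proj (f y))
  refine ⟨U ∩ f ⁻¹' e.source, Set.inter_subset_left,
    hf.continuousOn.isOpen_inter_preimage hU e.open_source, ⟨hy, e.mem_source.2 hx⟩,
    fun z => (e (f z)).2⁻¹ * (e (g z)).2, ?_, fun z hz =>
      (h.act_eq_iff he (e.mem_source.1 hz.2) (hfg z hz.1) _).2 rfl⟩
  have g1 : ContMDiffOn IN (IX.prod IB) ∞ (fun z => e (f z)) (U ∩ f ⁻¹' e.source) :=
    hsm.comp (hf.mono Set.inter_subset_left) fun z hz => hz.2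
  have g2 : ContMDiffOn IN (IX.prod IB) ∞ (fun z => e (g z)) (U ∩ f ⁻¹' e.source) :=
    hsm.comp (hg.mono Set.inter_subset_left) fun z hz =>
      e.mem_source.2 (hfg z hz.1 ▸ e.mem_source.1 hz.2)
  exact (contMDiff_snd.comp_contMDiffOn g1).inv.mul (contMDiff_snd.comp_contMDiffOn g2)

theorem mdifferentiableAt_act (h : IsPrincipalBundle IB IR IX proj act) (p : R × B) :
    MDifferentiableAt (IR.prod IB) IR (fun p : R × B => act p.1 p.2) p :=
  h.contMDiff_act.contMDiffAt.mdifferentiableAt (by simp)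

theorem mdifferentiable_act_left (h : IsPrincipalBundle IB IR IX proj act) (r : R) :
    MDifferentiable IB IR (act r) := fun _ =>
  (h.contMDiff_act.comp (contMDiff_const.prodMk contMDiff_id)
    |>.contMDiffAt).mdifferentiableAt (n := ∞) (by simp)

theorem mdifferentiable_act_right (h : IsPrincipalBundle IB IR IX proj act) (b : B) :
    MDifferentiable IR IR (fun r => act r b) := fun _ =>
  (h.contMDiff_act.comp (contMDiff_id.prodMk contMDiff_const)
    |>.contMDiffAt).mdifferentiableAt (n := ∞) (by simp)

/-- The difference equation, read on `R × B` via the diffeomorphism `(r, b) ↦ (r, r b)` onto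
`R ×_X R`. -/
theorem differenceEquation_iff [LieGroup IB ∞ B] (h : IsPrincipalBundle IB IR IX proj act)
    {EA : Type*} [NormedAddCommGroup EA] [NormedSpace ℝ EA] {HA : Type*} [TopologicalSpace HA]
    {IA : ModelWithCorners ℝ EA HA}
    {A : Type*} [TopologicalSpace A] [ChartedSpace HA A] [Group A]
    {t : GroupLieAlgebra IB B →L[ℝ] GroupLieAlgebra IA A}
    {η : OneForm IR R (GroupLieAlgebra IA A)} :
    DifferenceEquation h t η ↔ ∀ (p : R × B) (w : TangentSpace (IR.prod IB) p),
      η.pullback (fun p : R × B => act p.1 p.2) p w - η.pullback Prod.fst p w =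
        t ((maurerCartan IB B).pullback Prod.snd p w) := by
  let _ := h.chartedSpaceFibreProduct
  let Φ := h.homeomorphFibreProduct
  have hΦ : ∀ p, MDifferentiableAt (IR.prod IB) (IR.prod IB) Φ p := fun p =>
    h.contMDiff_homeomorphFibreProduct.contMDiffAt.mdifferentiableAt (by simp)
  have hΦ' : ∀ z, MDifferentiableAt (IR.prod IB) (IR.prod IB) Φ.symm z := fun z =>
    h.contMDiff_homeomorphFibreProduct_symm.contMDiffAt.mdifferentiableAt (by simp)
  have hval := (h.contMDiff_fibreProduct_iff (IN := IR.prod IB)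
    (fun z : FibreProduct proj => z)).1 contMDiff_id
  have h1 : ∀ z, MDifferentiableAt (IR.prod IB) IR (fun z : FibreProduct proj => z.1.1) z :=
    fun z => (contMDiff_fst.comp hval).contMDiffAt.mdifferentiableAt (n := ∞) (by simp)
  have h2 : ∀ z, MDifferentiableAt (IR.prod IB) IR (fun z : FibreProduct proj => z.1.2) z :=
    fun z => (contMDiff_snd.comp hval).contMDiffAt.mdifferentiableAt (n := ∞) (by simp)
  have h3 : ∀ z, MDifferentiableAt (IR.prod IB) IB h.diffMap z :=
    fun z => (h.contMDiffAt_diffMap_comp hval z).mdifferentiableAt (n := ∞) (by simp)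
  have hψ : (fun p => h.diffMap (Φ p)) = Prod.snd :=
    funext fun p => congrArg Prod.snd (Φ.symm_apply_apply p)
  have hact : (fun z => act (Φ.symm z).1 (Φ.symm z).2) = fun z : FibreProduct proj => z.1.2 :=
    funext fun z => h.act_diffMap z
  constructor
  · intro hE p w
    have e1 := η.pullback_comp_apply p (h2 _) (hΦ p) w
    have e2 := η.pullback_comp_apply p (h1 _) (hΦ p) w
    have e3 := (maurerCartan IB B).pullback_comp_apply p (h3 _) (hΦ p) w
    have e4 := congrArg (fun L : (ER × EB) →L[ℝ] EA => L (mfderiv (IR.prod IB) (IR.prod IB) Φ p w))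
      (congrFun hE (Φ p))
    rw [hψ] at e3
    rw [e3]
    exact (congrArg₂ (· - ·) e1 e2).trans e4
  · intro hE
    change _ = _
    funext z
    ext w
    have e1 := η.pullback_comp_apply z (h.mdifferentiableAt_act _) (hΦ' z) w
    have e2 := η.pullback_comp_apply z (mdifferentiableAt_fst (I := IR) (I' := IB)) (hΦ' z) w
    have e3 := (maurerCartan IB B).pullback_comp_apply z
      (mdifferentiableAt_snd (I := IR) (I' := IB)) (hΦ' z) w
    rw [hact] at e1
    have e4 := hE (Φ.symm z) (mfderiv (IR.prod IB) (IR.prod IB) Φ.symm z w)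
    rw [← e1, ← e2, ← e3] at e4
    exact e4

end IsPrincipalBundle

/-! ### Connections -/

namespace IsConnection

variable [IsManifold IR ∞ R] {η : OneForm IR R (GroupLieAlgebra IB B)}

/-- On the fibre through `r`, a connection form restricts to the Maurer-Cartan form. -/
theorem pullback_act_left [LieGroup IB ∞ B] (h : IsPrincipalBundle IB IR IX proj act)
    (hη : IsConnection IB IR act η) (r : R) (b : B) (ξ : TangentSpace IB b) :
    η.pullback (act r) b ξ = maurerCartan IB B b ξ := by
  -- left translation by `b⁻¹` reduces to the fundamental vectors at `r b`
  have h1 : act r = fun x => act (act r b) (b⁻¹ * x) := by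
    funext x; rw [← h.act_mul, mul_inv_cancel_left]
  have h2 := η.pullback_comp_apply b (h.mdifferentiable_act_left (act r b) (b⁻¹ * b))
    (mdifferentiableAt_mul_left (I := IB) b⁻¹ b) ξ
  have h3 : ∀ k : B, k = 1 → ∀ ζ : EB,
      η.pullback (I' := IB) (act (act r b)) k ζ = ζ := by
    rintro _ rfl ζ
    exact hη.vertical (act r b) ζ
  rw [h1]
  exact h2.trans (h3 _ (inv_mul_cancel b) _)

/-- The pullback of a connection form under `y ↦ f(y) g(y)` with `f` a map into the total space
and `g` a map into the structure group: the Leibniz rule `(f g)^* η = Ad_{g⁻¹} f^* η + g^* θ`. -/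
theorem pullback_act [LieGroup IB ∞ B] (h : IsPrincipalBundle IB IR IX proj act)
    (hη : IsConnection IB IR act η) {f : N → R} {g : N → B} {y : N}
    (hf : MDifferentiableAt IN IR f y) (hg : MDifferentiableAt IN IB g y)
    (w : TangentSpace IN y) :
    η.pullback (fun y => act (f y) (g y)) y w =
      Ad IB (g y)⁻¹ (η.pullback f y w) + (maurerCartan IB B).pullback g y w := by
  rw [η.pullback_prod_apply (F := fun p : R × B => act p.1 p.2)
    (h.mdifferentiableAt_act (f y, g y)) hf hg]
  exact congrArg₂ (· + ·) (hη.equivariant _ _ _) (hη.pullback_act_left h _ _ _)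

end IsConnection

end Bundles

/-! ### Central extensions and equivariant splittings -/

section Central

variable {EA : Type*} [NormedAddCommGroup EA] [NormedSpace ℝ EA] {HA : Type*} [TopologicalSpace HA]
  {IA : ModelWithCorners ℝ EA HA}
  {EB : Type*} [NormedAddCommGroup EB] [NormedSpace ℝ EB] {HB : Type*} [TopologicalSpace HB]
  {IB : ModelWithCorners ℝ EB HB}
  {EC : Type*} [NormedAddCommGroup EC] [NormedSpace ℝ EC] {HC : Type*} [TopologicalSpace HC]
  {IC : ModelWithCorners ℝ EC HC}
  {A : Type*} [TopologicalSpace A] [ChartedSpace HA A] [Group A]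
  {B : Type*} [TopologicalSpace B] [ChartedSpace HB B] [Group B]
  {C : Type*} [TopologicalSpace C] [ChartedSpace HC C] [Group C]
  {α : A →* B} {β : B →* C}

namespace IsLieCentralExtension

/-- The `A`-component of a trivialization of `β` near `1` is, up to a translation, a smooth left
inverse of `α`. -/
theorem lieMap_injective [LieGroup IA ∞ A] (h : IsLieCentralExtension IA IB IC α β) :
    Function.Injective (lieMap IA IB α) := by
  obtain ⟨e, hx, hsm, -, he⟩ := h.isPrincipalBundle.locally_trivial (β 1)
  have h1 : (1 : B) ∈ e.source := e.mem_source.2 hx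
  let g : B → A := fun b => (e 1).2⁻¹ * (e b).2
  have hα : MDifferentiableAt IA IB α 1 := h.contMDiff_left.contMDiffAt.mdifferentiableAt (by simp)
  have hg : MDifferentiableAt IB IA g 1 := by
    have : ContMDiffAt IB IA ∞ g 1 := contMDiffAt_const.mul
      (contMDiffAt_snd.comp _ (hsm.contMDiffAt (e.open_source.mem_nhds h1)))
    exact this.mdifferentiableAt (by simp)
  have hgα : g ∘ α = id := by
    funext a
    have := he 1 h1 a
    simp only [one_mul] at this
    simp [g, this]
  have h2 : ∀ ξ : EA, (show EA from mfderiv IB IA g 1 (lieMap IA IB α ξ)) = ξ := by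
    intro ξ
    have h3 := mfderiv_comp_apply_of_eq 1 hg hα (map_one α) ξ
    have h4 : mfderiv IA IA (g ∘ α) 1 = mfderiv IA IA (id : A → A) 1 :=
      Filter.EventuallyEq.mfderiv_eq (Filter.EventuallyEq.of_eq hgα)
    exact h3.symm.trans (congrArg (fun T : EA →L[ℝ] EA => T ξ) (h4.trans mfderiv_id))
  exact Function.LeftInverse.injective (g := fun v : EB => mfderiv IB IA g 1 v) h2

theorem map_map_eq_one (h : IsLieCentralExtension IA IB IC α β) (a : A) : β (α a) = 1 :=
  MonoidHom.mem_ker.1 (h.exact ▸ ⟨a, rfl⟩)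

theorem lieMap_lieMap (h : IsLieCentralExtension IA IB IC α β) (ξ : GroupLieAlgebra IA A) :
    lieMap IB IC β (lieMap IA IB α ξ) = 0 := by
  have h1 := mfderiv_comp_apply_of_eq 1
    (h.contMDiff_right.contMDiffAt.mdifferentiableAt (n := ∞) (by simp))
    (h.contMDiff_left.contMDiffAt.mdifferentiableAt (n := ∞) (by simp)) (map_one α) ξ
  have h2 : mfderiv IA IC (β ∘ α) 1 = mfderiv IA IC (fun _ : A => (1 : C)) 1 :=
    Filter.EventuallyEq.mfderiv_eq (Filter.EventuallyEq.of_eq (funext h.map_map_eq_one))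
  exact h1.symm.trans (congrArg (fun T : EA →L[ℝ] EC => T ξ) (h2.trans mfderiv_const))

theorem Ad_eq_id (h : IsLieCentralExtension IA IB IC α β) (a : A) :
    Ad IA a = ContinuousLinearMap.id ℝ _ :=
  Ad_of_central fun x => h.injective (by rw [map_mul, map_mul, h.central])

end IsLieCentralExtension

namespace IsEquivariantSplitting

variable {s : GroupLieAlgebra IC C →L[ℝ] GroupLieAlgebra IB B}
  {t : GroupLieAlgebra IB B →L[ℝ] GroupLieAlgebra IA A}

theorem retraction_lieMap [LieGroup IA ∞ A] (hs : IsEquivariantSplitting IA IB IC α β s t)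
    (h : IsLieCentralExtension IA IB IC α β) (ξ : GroupLieAlgebra IA A) :
    t (lieMap IA IB α ξ) = ξ := by
  apply h.lieMap_injective
  have := hs.decomposition (lieMap IA IB α ξ)
  rwa [h.lieMap_lieMap, map_zero, add_zero] at this

theorem retraction_section [LieGroup IA ∞ A] (hs : IsEquivariantSplitting IA IB IC α β s t)
    (h : IsLieCentralExtension IA IB IC α β) (ξ : GroupLieAlgebra IC C) : t (s ξ) = 0 := by
  apply h.lieMap_injective
  have := hs.decomposition (s ξ)
  rw [hs.section_right, add_eq_right] at this
  rw [this, map_zero]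

/-- The projection `t` is invariant under the adjoint action of `B`, as `s` is equivariant and
`B` acts trivially on the image of `𝔞`. -/
theorem retraction_Ad [LieGroup IA ∞ A] [LieGroup IB ∞ B]
    (hs : IsEquivariantSplitting IA IB IC α β s t)
    (h : IsLieCentralExtension IA IB IC α β) (b : B) (ξ : GroupLieAlgebra IB B) :
    t (Ad IB b ξ) = t ξ := by
  conv_lhs => rw [← hs.decomposition ξ, map_add, ← hs.section_equivariant,
    Ad_lieMap_of_central h.contMDiff_left h.central, map_add, hs.retraction_lieMap h,
    hs.retraction_section h, add_zero]

end IsEquivariantSplitting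

variable {EG : Type*} [NormedAddCommGroup EG] [NormedSpace ℝ EG] {HG : Type*} [TopologicalSpace HG]
  {IG : ModelWithCorners ℝ EG HG}
  {ER : Type*} [NormedAddCommGroup ER] [NormedSpace ℝ ER] {HR : Type*} [TopologicalSpace HR]
  {IR : ModelWithCorners ℝ ER HR}
  {EP : Type*} [NormedAddCommGroup EP] [NormedSpace ℝ EP] {HP : Type*} [TopologicalSpace HP]
  {IP : ModelWithCorners ℝ EP HP}
  {EX : Type*} [NormedAddCommGroup EX] [NormedSpace ℝ EX] {HX : Type*} [TopologicalSpace HX]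
  {IX : ModelWithCorners ℝ EX HX}
  {G : Type*} [TopologicalSpace G] [ChartedSpace HG G] [Group G]
  {R : Type*} [TopologicalSpace R] [ChartedSpace HR R]
  {P : Type*} [TopologicalSpace P] [ChartedSpace HP P]
  {X : Type*} [TopologicalSpace X] [ChartedSpace HX X]
  [MulAction G R] [MulAction G P] [MulAction G X]
  {ρ : R → X} {σ : R → P} {π : P → X} {actR : R → B → R} {actP : P → C → P}

theorem IsEquivariantPrincipalBundle.contMDiff_smul
    (h : IsEquivariantPrincipalBundle IB IR IX IG G ρ actR) (g : G) :
    ContMDiff IR IR ∞ (fun r : R => g • r) :=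
  h.contMDiffSMul.contMDiff_smul.comp (contMDiff_const.prodMk contMDiff_id)

/-- The map `σ` has local sections: move a local section of `ρ` into the fibres of `σ` by means of
a local section of `β`. -/
theorem IsEquivariantCentralExtension.hasLocalSections [LieGroup IC ∞ C]
    (hR : IsEquivariantCentralExtension IB IC IG IR IP IX G β ρ σ π actR actP)
    (hβ : HasLocalSections IB IC β) : HasLocalSections IR IP σ := by
  intro p
  obtain ⟨U, hU, hpU, τ, hτ, hs⟩ :=
    hR.bundle_total.toIsPrincipalBundle.hasLocalSections (π p)
  have hπ := hR.bundle_base.contMDiff_proj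
  have h1 : ContMDiffOn IP IR ∞ (fun q => τ (π q)) (π ⁻¹' U) :=
    hτ.comp hπ.contMDiffOn fun _ hq => hq
  obtain ⟨U', hU'U, hU', hpU', c, hc, hcs⟩ :=
    hR.bundle_base.toIsPrincipalBundle.exists_contMDiffOn_act_eq (hU.preimage hπ.continuous)
      (hR.contMDiff.comp_contMDiffOn h1) contMDiffOn_id
      (fun q hq => (hR.proj_map _).trans (hs _ hq)) hpU
  obtain ⟨W, hW, hpW, κ, hκ, hκs⟩ := hβ (c p)
  refine ⟨U' ∩ c ⁻¹' W, hc.continuousOn.isOpen_inter_preimage hU' hW, ⟨hpU', hpW⟩,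
    fun q => actR (τ (π q)) (κ (c q)), ?_, fun q hq => ?_⟩
  · exact hR.bundle_total.contMDiff_act.comp_contMDiffOn
      ((h1.mono fun q hq => hU'U hq.1).prodMk
        (hκ.comp (hc.mono Set.inter_subset_left) fun q hq => hq.2))
  · rw [hR.map_act, hκs _ hq.2]
    exact hcs q hq.1

end Central

/-! ### The correspondence of connections -/

section Correspondence

variable {EA EB EC EG ER EP EX A B C G R P X : Type*}
  [NormedAddCommGroup EA] [NormedSpace ℝ EA] [NormedAddCommGroup EB] [NormedSpace ℝ EB]
  [NormedAddCommGroup EC] [NormedSpace ℝ EC] [NormedAddCommGroup EG] [NormedSpace ℝ EG]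
  [NormedAddCommGroup ER] [NormedSpace ℝ ER] [NormedAddCommGroup EP] [NormedSpace ℝ EP]
  [NormedAddCommGroup EX] [NormedSpace ℝ EX]
  {HA HB HC HG HR HP HX : Type*} [TopologicalSpace HA] [TopologicalSpace HB] [TopologicalSpace HC]
  [TopologicalSpace HG] [TopologicalSpace HR] [TopologicalSpace HP] [TopologicalSpace HX]
  {IA : ModelWithCorners ℝ EA HA} {IB : ModelWithCorners ℝ EB HB} {IC : ModelWithCorners ℝ EC HC}
  {IG : ModelWithCorners ℝ EG HG} {IR : ModelWithCorners ℝ ER HR} {IP : ModelWithCorners ℝ EP HP}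
  {IX : ModelWithCorners ℝ EX HX}
  [TopologicalSpace A] [ChartedSpace HA A] [Group A]
  [TopologicalSpace B] [ChartedSpace HB B] [Group B]
  [TopologicalSpace C] [ChartedSpace HC C] [Group C]
  [Group G]
  [TopologicalSpace R] [ChartedSpace HR R] [MulAction G R]
  [TopologicalSpace P] [ChartedSpace HP P] [MulAction G P]
  [TopologicalSpace X] [ChartedSpace HX X]
  {α : A →* B} {β : B →* C}
  {s : GroupLieAlgebra IC C →L[ℝ] GroupLieAlgebra IB B}
  {t : GroupLieAlgebra IB B →L[ℝ] GroupLieAlgebra IA A}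
  {ρ : R → X} {σ : R → P} {π : P → X} {actR : R → B → R} {actP : P → C → P}

/-- As `A` is commutative, equivariance of `t η` means invariance, which follows from the
`Ad`-invariance of `t`. -/
theorem map_retraction_mem_equivariantConnections
    [LieGroup IA ∞ A] [LieGroup IB ∞ B] [IsManifold IR ∞ R]
    (hext : IsLieCentralExtension IA IB IC α β)
    (hs : IsEquivariantSplitting IA IB IC α β s t)
    (h : IsPrincipalBundle IB IR IX ρ actR)
    {η : OneForm IR R (GroupLieAlgebra IB B)} (hη : η ∈ equivariantConnections IB IR G actR) :
    η.map t ∈ equivariantConnections IA IR G (restrictAct α actR) := by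
  refine ⟨⟨hη.1.smooth.map t, fun r ξ => ?_, fun r a v => ?_⟩, fun g => ?_⟩
  · change t (η.pullback (fun a => actR r (α a)) 1 ξ) = ξ
    rw [η.pullback_comp_apply 1 (h.mdifferentiable_act_left r _)
      (hext.contMDiff_left.contMDiffAt.mdifferentiableAt (by simp)),
      hη.1.pullback_act_left h]
    have h3 : ∀ b : B, b = 1 → ∀ ζ : EB, maurerCartan IB B b ζ = ζ := by
      rintro _ rfl ζ
      rw [maurerCartan_one]; rfl
    exact (congrArg t (h3 _ (map_one α) _)).trans (hs.retraction_lieMap hext ξ)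
  · refine (congrArg t (hη.1.equivariant r (α a) v)).trans ?_
    rw [hs.retraction_Ad hext, hext.Ad_eq_id]
    rfl
  · rw [OneForm.map_pullback, hη.2 g]

variable [TopologicalSpace G] [ChartedSpace HG G] [MulAction G X]

theorem pullback_map_act (hR : IsEquivariantCentralExtension IB IC IG IR IP IX G β ρ σ π actR actP)
    {V : Type*} [TopologicalSpace V] [AddCommGroup V] [Module ℝ V] (η : OneForm IP P V) (b : B) :
    ((η.pullback σ : OneForm IR R V).pullback (fun r => actR r b) : OneForm IR R V) =
      (η.pullback (fun p => actP p (β b)) : OneForm IP P V).pullback σ := by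
  have hσ : MDifferentiable IR IP σ := hR.contMDiff.mdifferentiable (by simp)
  rw [η.pullback_pullback hσ (hR.bundle_total.toIsPrincipalBundle.mdifferentiable_act_right b),
    η.pullback_pullback (hR.bundle_base.toIsPrincipalBundle.mdifferentiable_act_right (β b)) hσ,
    funext fun r => hR.map_act r b]

theorem pullback_map_smul (hR : IsEquivariantCentralExtension IB IC IG IR IP IX G β ρ σ π actR actP)
    {V : Type*} [TopologicalSpace V] [AddCommGroup V] [Module ℝ V] (η : OneForm IP P V) (g : G) :
    ((η.pullback σ : OneForm IR R V).pullback (fun r => g • r) : OneForm IR R V) =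
      (η.pullback (fun p => g • p) : OneForm IP P V).pullback σ := by
  have hσ : MDifferentiable IR IP σ := hR.contMDiff.mdifferentiable (by simp)
  rw [η.pullback_pullback hσ ((hR.bundle_total.contMDiff_smul g).mdifferentiable (by simp)),
    η.pullback_pullback ((hR.bundle_base.contMDiff_smul g).mdifferentiable (by simp)) hσ,
    funext fun r => hR.map_smul g r]

/-- The map `σ` sends the fundamental vector `r ξ` to `σ(r) β_* ξ`. -/
theorem pullback_map_fundamental (hβ : ContMDiff IB IC ∞ β)
    (hR : IsEquivariantCentralExtension IB IC IG IR IP IX G β ρ σ π actR actP)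
    {V : Type*} [TopologicalSpace V] [AddCommGroup V] [Module ℝ V] (η : OneForm IP P V) (r : R)
    (ξ : GroupLieAlgebra IB B) :
    (η.pullback σ : OneForm IR R V).pullback (actR r) 1 ξ =
      η.pullback (actP (σ r)) 1 (lieMap IB IC β ξ) := by
  have h1 := η.pullback_comp_apply 1
    (hR.contMDiff.contMDiffAt.mdifferentiableAt (n := ∞) (by simp))
    (hR.bundle_total.toIsPrincipalBundle.mdifferentiable_act_left r 1) ξ
  have h2 := η.pullback_comp_apply 1
    (hR.bundle_base.toIsPrincipalBundle.mdifferentiable_act_left (σ r) (β 1))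
    (hβ.contMDiffAt.mdifferentiableAt (n := ∞) (by simp)) ξ
  rw [funext fun b => hR.map_act r b] at h1
  -- the derivative of `β` at `1` takes values in the tangent space at `β 1`
  have h3 : ∀ c : C, c = 1 → ∀ ζ : EC, η.pullback (I' := IC) (actP (σ r)) c ζ =
      η.pullback (I' := IC) (actP (σ r)) 1 ζ := by
    rintro _ rfl ζ; rfl
  exact h1.symm.trans (h2.trans (h3 _ (map_one β) _))

/-- The difference equation along `r' ↦ (r', r' b)`: the form is invariant under right
translation. -/
theorem DifferenceEquation.pullback_act_right [LieGroup IB ∞ B]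
    {h : IsPrincipalBundle IB IR IX ρ actR}
    {η : OneForm IR R (GroupLieAlgebra IA A)} (hE : DifferenceEquation h t η) (b : B) :
    η.pullback (fun r => actR r b) = η := by
  funext r
  ext v
  have hf : MDifferentiableAt IR (IR.prod IB) (fun r : R => (r, b)) r :=
    mdifferentiableAt_id.prodMk mdifferentiableAt_const
  have h1 := h.differenceEquation_iff.1 hE (r, b) (mfderiv IR (IR.prod IB) (fun r => (r, b)) r v)
  rw [← η.pullback_comp_apply r (h.mdifferentiableAt_act _) hf,
    ← η.pullback_comp_apply r mdifferentiableAt_fst hf,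
    ← (maurerCartan IB B).pullback_comp_apply r mdifferentiableAt_snd hf, η.pullback_id] at h1
  have h2 : (maurerCartan IB B).pullback (fun _ : R => b) r v = 0 := by
    have h3 : mfderiv IR IB (fun _ : R => b) r = 0 := mfderiv_const
    exact (congrArg (maurerCartan IB B b) (congrArg (fun T : ER →L[ℝ] EB => T v) h3)).trans
      (map_zero _)
  rw [h2, map_zero, sub_eq_zero] at h1
  exact h1

/-- The difference equation along `b ↦ (r, r b)`: the form takes the value `t ξ` on the
fundamental vector `r ξ`. -/
theorem DifferenceEquation.pullback_act_left [LieGroup IB ∞ B]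
    {h : IsPrincipalBundle IB IR IX ρ actR}
    {η : OneForm IR R (GroupLieAlgebra IA A)} (hE : DifferenceEquation h t η) (r : R)
    (ξ : GroupLieAlgebra IB B) : η.pullback (actR r) 1 ξ = t ξ := by
  have hf : MDifferentiableAt IB (IR.prod IB) (fun b : B => (r, b)) 1 :=
    mdifferentiableAt_const.prodMk mdifferentiableAt_id
  have h1 := h.differenceEquation_iff.1 hE (r, 1) (mfderiv IB (IR.prod IB) (fun b => (r, b)) 1 ξ)
  rw [← η.pullback_comp_apply 1 (h.mdifferentiableAt_act _) hf,
    ← η.pullback_comp_apply 1 mdifferentiableAt_fst hf,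
    ← (maurerCartan IB B).pullback_comp_apply 1 mdifferentiableAt_snd hf,
    (maurerCartan IB B).pullback_id, maurerCartan_one] at h1
  have h2 : η.pullback (fun _ : B => r) 1 ξ = 0 := by
    have h3 : mfderiv IB IR (fun _ : B => r) 1 = 0 := mfderiv_const
    exact (congrArg (η r) (congrArg (fun T : EB →L[ℝ] ER => T ξ) h3)).trans (map_zero _)
  rw [h2, sub_zero] at h1
  exact h1

theorem formOfPair_mem_equivariantConnections
    [LieGroup IA ∞ A] [LieGroup IB ∞ B] [LieGroup IC ∞ C]
    [IsManifold IR ∞ R] [IsManifold IP ∞ P]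
    (hext : IsLieCentralExtension IA IB IC α β)
    (hs : IsEquivariantSplitting IA IB IC α β s t)
    (hR : IsEquivariantCentralExtension IB IC IG IR IP IX G β ρ σ π actR actP)
    {η : OneForm IR R (GroupLieAlgebra IA A)} {ζ : OneForm IP P (GroupLieAlgebra IC C)}
    (hη : η ∈ equivariantConnections IA IR G (restrictAct α actR))
    (hζ : ζ ∈ equivariantConnections IC IP G actP)
    (hE : DifferenceEquation hR.bundle_total.toIsPrincipalBundle t η) :
    formOfPair α s σ (η, ζ) ∈ equivariantConnections IB IR G actR := by
  refine ⟨⟨(hη.1.smooth.map _).add ((hζ.1.smooth.pullback hR.contMDiff).map s), fun r ξ => ?_,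
    fun r b v => ?_⟩, fun g => ?_⟩
  · change lieMap IA IB α (η.pullback (actR r) 1 ξ) +
      s ((ζ.pullback σ : OneForm IR R _).pullback (actR r) 1 ξ) = ξ
    have h1 : ζ.pullback (actP (σ r)) 1 (lieMap IB IC β ξ) = lieMap IB IC β ξ :=
      hζ.1.vertical _ _
    rw [hE.pullback_act_left, pullback_map_fundamental hext.contMDiff_right hR, h1,
      hs.decomposition]
  · change lieMap IA IB α (η.pullback (fun r => actR r b) r v) +
      s ((ζ.pullback σ : OneForm IR R _).pullback (fun r => actR r b) r v) =
      Ad IB b⁻¹ (lieMap IA IB α (η r v) + s (ζ.pullback σ r v))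
    have h1 : (ζ.pullback (fun p => actP p (β b)) : OneForm IP P _) = ζ.map (Ad IC (β b)⁻¹) := by
      funext p
      ext w
      exact hζ.1.equivariant _ _ _
    rw [hE.pullback_act_right, pullback_map_act hR, h1, map_add,
      Ad_lieMap_of_central hext.contMDiff_left hext.central, ← hs.section_equivariant, map_inv]
    rfl
  · have h1 := pullback_map_smul hR ζ g
    rw [hζ.2 g] at h1
    funext r
    ext v
    change lieMap IA IB α (η.pullback (fun r => g • r) r v) +
      s ((ζ.pullback σ : OneForm IR R _).pullback (fun r => g • r) r v) = _
    rw [hη.2 g, h1]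
    rfl

theorem map_retraction_formOfPair [LieGroup IA ∞ A]
    (hext : IsLieCentralExtension IA IB IC α β)
    (hs : IsEquivariantSplitting IA IB IC α β s t)
    (q : OneForm IR R (GroupLieAlgebra IA A) × OneForm IP P (GroupLieAlgebra IC C)) :
    (formOfPair α s σ q).map t = q.1 := by
  funext r
  ext v
  change t (lieMap IA IB α (q.1 r v) + s (q.2.pullback σ r v)) = _
  rw [map_add, hs.retraction_lieMap hext, hs.retraction_section hext, add_zero]

theorem map_lieMap_formOfPair
    (hext : IsLieCentralExtension IA IB IC α β)
    (hs : IsEquivariantSplitting IA IB IC α β s t)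
    (q : OneForm IR R (GroupLieAlgebra IA A) × OneForm IP P (GroupLieAlgebra IC C)) :
    (formOfPair α s σ q).map (lieMap IB IC β) = q.2.pullback σ := by
  funext r
  ext v
  change lieMap IB IC β (lieMap IA IB α (q.1 r v) + s (q.2.pullback σ r v)) = _
  rw [map_add, hext.lieMap_lieMap, hs.section_right, zero_add]

/-- The Leibniz rule for `(r, b) ↦ r b`, with the `Ad`-invariance of `t`. -/
theorem IsConnection.differenceEquation_map
    [LieGroup IA ∞ A] [LieGroup IB ∞ B] [IsManifold IR ∞ R]
    (hext : IsLieCentralExtension IA IB IC α β)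
    (hs : IsEquivariantSplitting IA IB IC α β s t)
    (h : IsPrincipalBundle IB IR IX ρ actR)
    {η : OneForm IR R (GroupLieAlgebra IB B)} (hη : IsConnection IB IR actR η) :
    DifferenceEquation h t (η.map t) := by
  refine h.differenceEquation_iff.2 fun p w => ?_
  change t (η.pullback (fun p : R × B => actR p.1 p.2) p w) - t (η.pullback Prod.fst p w) = _
  rw [hη.pullback_act h (mdifferentiableAt_fst (I := IR) (I' := IB))
    (mdifferentiableAt_snd (I := IR) (I' := IB)), map_add, hs.retraction_Ad hext,
    add_sub_cancel_left]

/-- The form `β_* η` descends to a connection on `π`. It descends as a form because a local smooth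
map `r ↦ r b(r)` over `P` has `β(b(r)) = 1`, so that both terms in which the pullback of `β_* η`
could differ from `β_* η` are trivial. -/
theorem exists_pullback_eq_map_lieMap
    [LieGroup IB ∞ B] [LieGroup IC ∞ C] [IsManifold IR ∞ R] [IsManifold IP ∞ P]
    (hext : IsLieCentralExtension IA IB IC α β)
    (hs : IsEquivariantSplitting IA IB IC α β s t)
    (hR : IsEquivariantCentralExtension IB IC IG IR IP IX G β ρ σ π actR actP)
    {η : OneForm IR R (GroupLieAlgebra IB B)} (hη : η ∈ equivariantConnections IB IR G actR) :
    ∃ ζ ∈ equivariantConnections IC IP G actP, ζ.pullback σ = η.map (lieMap IB IC β) := by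
  have hρ := hR.bundle_total.toIsPrincipalBundle
  have hσ := hR.hasLocalSections hext.isPrincipalBundle.hasLocalSections
  obtain ⟨ζ, hζs, hζ⟩ := hσ.exists_pullback_eq hR.contMDiff
      (hη.1.smooth.map (lieMap IB IC β)) <| by
    intro U g hU hg hgs r hr
    obtain ⟨U', hU'U, hU', hr', b, hb, hbs⟩ := hρ.exists_contMDiffOn_act_eq hU contMDiffOn_id hg
      (fun z hz => by rw [id, ← hR.proj_map, ← hR.proj_map, hgs z hz]) hr
    have hb1 : ∀ z ∈ U', β (b z) = 1 := fun z hz => by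
      refine hR.bundle_base.toIsPrincipalBundle.eq_one_of_act_eq (r := σ z) ?_
      rw [← hR.map_act, ← hgs z (hU'U hz)]
      exact congrArg σ (hbs z hz)
    have hbr : MDifferentiableAt IR IB b r :=
      (hb.contMDiffAt (hU'.mem_nhds hr')).mdifferentiableAt (by simp)
    have hcongr : g =ᶠ[nhds r] fun z => actR z (b z) := by
      filter_upwards [hU'.mem_nhds hr'] with z hz using (hbs z hz).symm
    ext v
    change lieMap IB IC β (η.pullback g r v) = lieMap IB IC β (η r v)
    rw [η.pullback_congr hcongr,
      hη.1.pullback_act hρ (f := fun z => z) mdifferentiableAt_id hbr, η.pullback_id, map_add,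
      lieMap_Ad hext.contMDiff_right, map_inv, hb1 r hr', inv_one,
      Ad_of_central (k := (1 : C)) (fun x => by simp),
      lieMap_maurerCartan_pullback_eq_zero hext.contMDiff_right hbr (l := 1)
        (by filter_upwards [hU'.mem_nhds hr'] with z hz using hb1 z hz),
      add_zero]
    rfl
  refine ⟨ζ, ⟨⟨hζs, fun p ξ => ?_, fun p c v => ?_⟩, fun g => ?_⟩, hζ⟩
  · obtain ⟨r, rfl⟩ := hσ.surjective p
    -- `s ξ` is a lift of `ξ` along `β_*`
    have h1 := pullback_map_fundamental hext.contMDiff_right hR ζ r (s ξ)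
    rw [hs.section_right, hζ] at h1
    refine h1.symm.trans ((congrArg (lieMap IB IC β) (hη.1.vertical r (s ξ))).trans ?_)
    exact hs.section_right ξ
  · obtain ⟨b, rfl⟩ := hext.surjective c
    have h1 : (ζ.pullback (fun p => actP p (β b)) : OneForm IP P _) = ζ.map (Ad IC (β b)⁻¹) := by
      refine hσ.pullback_injective hR.contMDiff ?_
      rw [← pullback_map_act hR, OneForm.map_pullback, hζ]
      funext r
      ext w
      refine (congrArg (lieMap IB IC β) (hη.1.equivariant r b w)).trans ?_
      rw [lieMap_Ad hext.contMDiff_right, map_inv]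
      rfl
    exact congrArg (fun χ : OneForm IP P (GroupLieAlgebra IC C) => χ p v) h1
  · refine hσ.pullback_injective hR.contMDiff ?_
    rw [← pullback_map_smul hR, hζ, OneForm.map_pullback, hη.2 g]

end Correspondence

end CentralExt

end

theorem theorem3
    {EA EB EC EG ER EP EX A B C G R P X : Type*}
    [NormedAddCommGroup EA] [NormedSpace ℝ EA] [NormedAddCommGroup EB] [NormedSpace ℝ EB]
    [NormedAddCommGroup EC] [NormedSpace ℝ EC] [NormedAddCommGroup EG] [NormedSpace ℝ EG]
    [NormedAddCommGroup ER] [NormedSpace ℝ ER] [NormedAddCommGroup EP] [NormedSpace ℝ EP]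
    [NormedAddCommGroup EX] [NormedSpace ℝ EX]
    -- the Lie groups
    [TopologicalSpace A] [ChartedSpace EA A] [Group A] [LieGroup 𝓘(ℝ, EA) ∞ A]
    [TopologicalSpace B] [ChartedSpace EB B] [Group B] [LieGroup 𝓘(ℝ, EB) ∞ B]
    [TopologicalSpace C] [ChartedSpace EC C] [Group C] [LieGroup 𝓘(ℝ, EC) ∞ C]
    [TopologicalSpace G] [ChartedSpace EG G] [Group G] [LieGroup 𝓘(ℝ, EG) ∞ G]
    -- the manifolds, with their actions of `G`
    [TopologicalSpace R] [ChartedSpace ER R] [IsManifold 𝓘(ℝ, ER) ∞ R] [MulAction G R]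
    [TopologicalSpace P] [ChartedSpace EP P] [IsManifold 𝓘(ℝ, EP) ∞ P] [MulAction G P]
    [TopologicalSpace X] [ChartedSpace EX X] [IsManifold 𝓘(ℝ, EX) ∞ X] [MulAction G X]
    -- the central extension and its equivariant splitting
    (α : A →* B) (β : B →* C)
    (hext : CentralExt.IsLieCentralExtension 𝓘(ℝ, EA) 𝓘(ℝ, EB) 𝓘(ℝ, EC) α β)
    (s : GroupLieAlgebra 𝓘(ℝ, EC) C →L[ℝ] GroupLieAlgebra 𝓘(ℝ, EB) B)
    (t : GroupLieAlgebra 𝓘(ℝ, EB) B →L[ℝ] GroupLieAlgebra 𝓘(ℝ, EA) A)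
    (hsplit : CentralExt.IsEquivariantSplitting 𝓘(ℝ, EA) 𝓘(ℝ, EB) 𝓘(ℝ, EC) α β s t)
    -- the bundles `R → P → X`
    (ρ : R → X) (σ : R → P) (π : P → X) (actR : R → B → R) (actP : P → C → P)
    (hR : CentralExt.IsEquivariantCentralExtension 𝓘(ℝ, EB) 𝓘(ℝ, EC) 𝓘(ℝ, EG) 𝓘(ℝ, ER)
      𝓘(ℝ, EP) 𝓘(ℝ, EX) G β ρ σ π actR actP) :
    -- the pairs `(ω^σ, ω^π)` of `G`-connections on `σ` and `π` satisfying the equation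
    let pairs : Set
        (CentralExt.OneForm 𝓘(ℝ, ER) R (GroupLieAlgebra 𝓘(ℝ, EA) A) ×
          CentralExt.OneForm 𝓘(ℝ, EP) P (GroupLieAlgebra 𝓘(ℝ, EC) C)) :=
      {q | q.1 ∈ CentralExt.equivariantConnections 𝓘(ℝ, EA) 𝓘(ℝ, ER) G
              (CentralExt.restrictAct α actR) ∧
            q.2 ∈ CentralExt.equivariantConnections 𝓘(ℝ, EC) 𝓘(ℝ, EP) G actP ∧
            CentralExt.DifferenceEquation hR.bundle_total.toIsPrincipalBundle t q.1}
    Set.BijOn (CentralExt.formOfPair α s σ) pairs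
        (CentralExt.equivariantConnections 𝓘(ℝ, EB) 𝓘(ℝ, ER) G actR) ∧
      ∀ q ∈ pairs,
        (CentralExt.formOfPair α s σ q).map t = q.1 ∧
        (CentralExt.formOfPair α s σ q).map (CentralExt.lieMap 𝓘(ℝ, EB) 𝓘(ℝ, EC) β) =
          q.2.pullback σ := by
  refine ⟨⟨?_, ?_, ?_⟩, fun q _ => ⟨CentralExt.map_retraction_formOfPair hext hsplit q,
    CentralExt.map_lieMap_formOfPair hext hsplit q⟩⟩
  · rintro ⟨η, ζ⟩ ⟨hη, hζ, hE⟩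
    exact CentralExt.formOfPair_mem_equivariantConnections hext hsplit hR hη hζ hE
  · intro q _ q' _ heq
    refine Prod.ext ?_ ?_
    · rw [← CentralExt.map_retraction_formOfPair (σ := σ) hext hsplit q, heq,
        CentralExt.map_retraction_formOfPair hext hsplit]
    · refine (hR.hasLocalSections hext.isPrincipalBundle.hasLocalSections).pullback_injective
        hR.contMDiff ?_
      rw [← CentralExt.map_lieMap_formOfPair hext hsplit q, heq,
        CentralExt.map_lieMap_formOfPair hext hsplit]
  · intro η hη
    obtain ⟨ζ, hζ, hζη⟩ := CentralExt.exists_pullback_eq_map_lieMap hext hsplit hR hη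
    have hρ := hR.bundle_total.toIsPrincipalBundle
    refine ⟨(η.map t, ζ), ⟨CentralExt.map_retraction_mem_equivariantConnections hext hsplit hρ hη,
      hζ, hη.1.differenceEquation_map hext hsplit hρ⟩, ?_⟩
    funext r
    ext v
    have h1 : ζ.pullback σ r v = CentralExt.lieMap 𝓘(ℝ, EB) 𝓘(ℝ, EC) β (η r v) := by
      rw [hζη]; rfl
    change CentralExt.lieMap 𝓘(ℝ, EA) 𝓘(ℝ, EB) α (t (η r v)) + s (ζ.pullback σ r v) = η r v
    rw [h1, hsplit.decomposition]
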